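/- **Proposition 2.4** (group cocycle integrating the Neeb cocycle). Let $G$ be a finite-dimensional smooth Lie group with Lie algebra $\mathfrak g$ and let $S$ be a smooth finite-dimensional manifold. Let $C^\infty(S,G)$ and $C^\infty(S,\mathfrak g)$ be the current group and the current Lie algebra (with pointwise operations), which act trivially on $\Omega^1(S)$. Let $\alpha:\mathfrak g\to\mathfrak g^*$ be a Lie algebra 1-cocycle for the coadjoint action, and let $p$ and $\omega$ be the symmetric and the skew-symmetric part of the bilinear form $(x,y)\mapsto\alpha(x)y$, so that $\alpha(x)y=p(x,y)+\omega(x,y)$. Then the Neeb cocycle $$\sigma_N(u,v)=p(u,dv)-p(du,v)+d(\omega(u,v))\in\Omega^1(S),\qquad u,v\in C^\infty(S,\mathfrak g),$$ is a Lie algebra 2-cocycle on $C^\infty(S,\mathfrak g)$, and the following hold. (1) Let $a:G\to\mathfrak g^*$ be a smooth map with derivative $\alpha$ at the identity that is a group 1-cocycle for the right coadjoint action, i.e. $a(gh)=a(h)+a(g)\circ\mathrm{Ad}_h$ for all $g,h\in G$. Then $$c(g_1,g_2)=a(g_1)(dg_2\,g_2^{-1})\in\Omega^1(S)$$ is a smooth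 group 2-cocycle on $C^\infty(S,G)$, and its associated Lie algebra 2-cocycle is $\sigma_N$. (2) Let $a:G\to\mathfrak g^*$ be a smooth map with derivative $\alpha$ at the identity that is a group 1-cocycle for the left coadjoint action, i.e. $a(gh)=a(g)+a(h)\circ\mathrm{Ad}_{g^{-1}}$ for all $g,h\in G$. Then $$c(g_1,g_2)=\big(a(g_1)\circ\mathrm{Ad}_{g_1}\big)(dg_2\,g_2^{-1})\in\Omega^1(S)$$ is a smooth group 2-cocycle on $C^\infty(S,G)$, and its associated Lie algebra 2-cocycle is $\sigma_N$. Here $dg\,g^{-1}$ is the right logarithmic derivative, a $\mathfrak g$-valued 1-form on $S$. A 2-cochain $c$ is smooth if for all $n$ and all families $\gamma_q,\eta_q$ ($q\in\mathbb R^n$) in $C^\infty(S,G)$ that are smooth in $(q,x)\in\mathbb R^n\times S$, the family of 1-forms $c(\gamma_q,\eta_q)$ is smooth in $(q,x)$. The associated Lie algebra 2-cocycle of $c$ is $$(u,v)\mapsto\frac{\partial^2}{\partial s\,\partial t}\Big|_{s=t=0}\big(c(\gamma_s,\eta_t)-c(\eta_t,\gamma_s)\big)$$ for any smooth curves $\gamma,\eta$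 in $C^\infty(S,G)$ through the constant map $1$ at parameter $0$ with velocities $u,v\in C^\infty(S,\mathfrak g)$ there. -/

import Mathlib

open scoped Manifold ContDiff

noncomputable section

namespace CurrentCocycle

/-! ### The Lie group `G` and its Lie algebra -/

section LieGroup

variable {E : Type*} [NormedAddCommGroup E] [NormedSpace ℝ E] [FiniteDimensional ℝ E]
  {H : Type*} [TopologicalSpace H] {I : ModelWithCorners ℝ E H}
  {G : Type*} [TopologicalSpace G] [ChartedSpace H G] [Group G] [LieGroup I ∞ G]

/-- Over `ℝ`, Mathlib's order of smoothness `minSmoothness ℝ 3` is `3`, so that a smooth Lie group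
has a Lie algebra `GroupLieAlgebra I G = T₁G` (with the bracket of left-invariant fields). -/
instance instLEInftyMinSmoothness : ENat.LEInfty (minSmoothness ℝ 3) := by
  rw [minSmoothness_of_isRCLikeNormedField]; infer_instance

variable (I) in
/-- The adjoint action `Ad g : 𝔤 → 𝔤`, the derivative at `1` of `h ↦ g h g⁻¹`. -/
def Ad (g : G) : GroupLieAlgebra I G →L[ℝ] GroupLieAlgebra I G :=
  mfderiv I I (fun h : G => g * h * g⁻¹) 1

/-- The left coadjoint action of `G` on `𝔤*`: `(Ad*_g l)(y) = l (Ad(g⁻¹) y)`. -/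
def coadjoint (g : G) (l : Module.Dual ℝ (GroupLieAlgebra I G)) :
    Module.Dual ℝ (GroupLieAlgebra I G) :=
  l ∘ₗ (Ad I g⁻¹ : GroupLieAlgebra I G →ₗ[ℝ] GroupLieAlgebra I G)

/-- `a : G → 𝔤*` is a group 1-cocycle for the left coadjoint action:
`a (g h) = a g + Ad*_g (a h)`. -/
def IsLeftOneCocycle (a : G → Module.Dual ℝ (GroupLieAlgebra I G)) : Prop :=
  ∀ g h : G, a (g * h) = a g + coadjoint g (a h)

/-- `a : G → 𝔤*` is a group 1-cocycle for the right coadjoint action `l · g = Ad*_{g⁻¹} l`: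
`a (g h) = a h + (a g) · h`. -/
def IsRightOneCocycle (a : G → Module.Dual ℝ (GroupLieAlgebra I G)) : Prop :=
  ∀ g h : G, a (g * h) = a h + coadjoint h⁻¹ (a g)

/-- `a : G → 𝔤*` is smooth and its derivative at `1` is `α : 𝔤 → 𝔤*`. (Since `𝔤` is
finite-dimensional, both can be tested by evaluating at the elements of `𝔤`.) -/
structure Integrates (a : G → Module.Dual ℝ (GroupLieAlgebra I G))
    (α : GroupLieAlgebra I G →ₗ[ℝ] Module.Dual ℝ (GroupLieAlgebra I G)) : Prop where
  smooth : ∀ y, ContMDiff I 𝓘(ℝ, ℝ) ∞ (fun g => a g y)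
  deriv_one : ∀ x y, mvfderiv I (fun g => a g y) (1 : G) x = α x y

/-- The symmetric part `p` of `(x, y) ↦ α x y`. -/
def symmPart (α : GroupLieAlgebra I G →ₗ[ℝ] Module.Dual ℝ (GroupLieAlgebra I G))
    (x y : GroupLieAlgebra I G) : ℝ := (α x y + α y x) / 2

/-- The skew-symmetric part `ω` of `(x, y) ↦ α x y`. -/
def skewPart (α : GroupLieAlgebra I G →ₗ[ℝ] Module.Dual ℝ (GroupLieAlgebra I G))
    (x y : GroupLieAlgebra I G) : ℝ := (α x y - α y x) / 2

variable (I G) in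
/-- The Lie bracket of `𝔤` as a bilinear map on the model space `E`
(`𝔤 = T₁G` is by definition a copy of `E`). -/
def bracketBilin : E →ₗ[ℝ] E →ₗ[ℝ] E :=
  LinearMap.mk₂ ℝ
    (fun x y => (⁅(show GroupLieAlgebra I G from x), (show GroupLieAlgebra I G from y)⁆ :
      GroupLieAlgebra I G))
    (fun x y z => add_lie (L := GroupLieAlgebra I G) (M := GroupLieAlgebra I G) x y z)
    (fun c x y => smul_lie (R := ℝ) (L := GroupLieAlgebra I G) (M := GroupLieAlgebra I G) c x y)
    (fun x y z => lie_add (L := GroupLieAlgebra I G) (M := GroupLieAlgebra I G) x y z)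
    (fun c x y => lie_smul (R := ℝ) (L := GroupLieAlgebra I G) (M := GroupLieAlgebra I G) c x y)

end LieGroup

/-! ### Current groups, current algebras and 1-forms -/

section Current

variable {E : Type*} [NormedAddCommGroup E] [NormedSpace ℝ E] [FiniteDimensional ℝ E]
  {H : Type*} [TopologicalSpace H] (I : ModelWithCorners ℝ E H)
  (G : Type*) [TopologicalSpace G] [ChartedSpace H G] [Group G] [LieGroup I ∞ G]
  {F : Type*} [NormedAddCommGroup F] [NormedSpace ℝ F]
  {H' : Type*} [TopologicalSpace H'] (J : ModelWithCorners ℝ F H')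
  (S : Type*) [TopologicalSpace S] [ChartedSpace H' S]

/-- The current group `C^∞(S, G)`, with pointwise multiplication. -/
abbrev CurrentGroup : Type _ := C^∞⟮J, S; I, G⟯

/-- `Ω¹(S)`: smooth sections of the cotangent bundle of `S`. -/
abbrev OneForm [IsManifold J ∞ S] : Type _ :=
  ContMDiffSection J (F →L[ℝ] ℝ) ∞ (fun x : S => TangentSpace J x →L[ℝ] Bundle.Trivial S ℝ x)

/-- The vector space `C^∞(S, 𝔤)`; smoothness is with respect to the vector space structure of
`𝔤 = T₁G`, which is a copy of the model space `E`. -/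
def CurrentAlgebra : Submodule ℝ (S → GroupLieAlgebra I G) where
  carrier := {u | ContMDiff J 𝓘(ℝ, E) ∞ (M' := E) u}
  add_mem' {u v} hu hv := ContMDiff.add (G := E) hu hv
  zero_mem' := contMDiff_const (M' := E) (c := (0 : E))
  smul_mem' c u hu := by
    have hu' : ContMDiff J 𝓘(ℝ, E) ∞ (M' := E) u := hu
    exact (contDiff_const_smul (F := E) c).contMDiff.comp hu'

variable {I G J S}

/-- The pointwise bracket of smooth `𝔤`-valued maps is smooth. -/
theorem bracket_mem {u v : S → GroupLieAlgebra I G} (hu : u ∈ CurrentAlgebra I G J S)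
    (hv : v ∈ CurrentAlgebra I G J S) :
    (fun x => ⁅u x, v x⁆) ∈ CurrentAlgebra I G J S := by
  have hu' : ContMDiff J 𝓘(ℝ, E) ∞ (M' := E) u := hu
  have hv' : ContMDiff J 𝓘(ℝ, E) ∞ (M' := E) v := hv
  have hB : ContMDiff (𝓘(ℝ, E × E)) 𝓘(ℝ, E) ∞ (fun q : E × E => bracketBilin I G q.1 q.2) :=
    (LinearMap.toContinuousBilinearMap (bracketBilin I G)).isBoundedBilinearMap.contDiff.contMDiff
  exact hB.comp (hu'.prodMk_space hv')

/-- The pointwise Lie bracket of the current algebra `C^∞(S, 𝔤)`. -/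
instance : LieRing (CurrentAlgebra I G J S) where
  bracket u v := ⟨fun x => ⁅u.1 x, v.1 x⁆, bracket_mem u.2 v.2⟩
  add_lie u v w := Subtype.ext (funext fun x => add_lie (u.1 x) (v.1 x) (w.1 x))
  lie_add u v w := Subtype.ext (funext fun x => lie_add (u.1 x) (v.1 x) (w.1 x))
  lie_self u := Subtype.ext (funext fun x => lie_self (u.1 x))
  leibniz_lie u v w := Subtype.ext (funext fun x => leibniz_lie (u.1 x) (v.1 x) (w.1 x))

instance : LieAlgebra ℝ (CurrentAlgebra I G J S) where
  lie_smul t u v := Subtype.ext (funext fun x => lie_smul t (u.1 x) (v.1 x))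

/-- The differential `dv : T_xS → 𝔤` of `v ∈ C^∞(S, 𝔤)`. -/
def dAlg (v : CurrentAlgebra I G J S) (x : S) : TangentSpace J x →L[ℝ] GroupLieAlgebra I G :=
  mvfderiv J (F := E) v.1 x

/-- The right logarithmic derivative `dg g⁻¹ : T_xS → 𝔤` of `g ∈ C^∞(S, G)`: the derivative of `g`
at `x`, followed by the derivative of the right translation by `g(x)⁻¹`. -/
def rightLogDeriv (g : CurrentGroup I G J S) (x : S) :
    TangentSpace J x →L[ℝ] GroupLieAlgebra I G :=
  (mfderiv I I (fun h : G => h * (g x)⁻¹) (g x) :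
      TangentSpace I (g x) →L[ℝ] GroupLieAlgebra I G) ∘L mfderiv J I g x

/-- The value at `w ∈ T_xS` of the Neeb form
`σ_N(u, v) = p(u, dv) - p(du, v) + d(ω(u, v))`. -/
def neebForm (α : GroupLieAlgebra I G →ₗ[ℝ] Module.Dual ℝ (GroupLieAlgebra I G))
    (u v : CurrentAlgebra I G J S) (x : S) (w : TangentSpace J x) : ℝ :=
  symmPart α (u.1 x) (dAlg v x w) - symmPart α (dAlg u x w) (v.1 x)
    + mvfderiv J (fun y => skewPart α (u.1 y) (v.1 y)) x w

variable [IsManifold J ∞ S]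

/-- Group 2-cocycles on the current group with values in the trivial module `Ω¹(S)`. -/
def IsGroupTwoCocycle (c : CurrentGroup I G J S → CurrentGroup I G J S → OneForm J S) : Prop :=
  ∀ g₁ g₂ g₃, c g₂ g₃ - c (g₁ * g₂) g₃ + c g₁ (g₂ * g₃) - c g₁ g₂ = 0

/-- A family `(γ_p)` in `C^∞(S, G)`, with parameter `p` in a normed space, is smooth if
`(p, x) ↦ γ_p(x)` is smooth. -/
def IsSmoothFamily {P : Type*} [NormedAddCommGroup P] [NormedSpace ℝ P]
    (γ : P → CurrentGroup I G J S) : Prop :=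
  ContMDiff (𝓘(ℝ, P).prod J) I ∞ (fun q : P × S => γ q.1 q.2)

/-- A family `(β_p)` in `Ω¹(S)`, with parameter `p` in a normed space, is smooth if
`(p, x) ↦ (β_p)_x ∈ T*_xS` is smooth. -/
def IsSmoothFormFamily {P : Type*} [NormedAddCommGroup P] [NormedSpace ℝ P]
    (β : P → OneForm J S) : Prop :=
  ContMDiff (𝓘(ℝ, P).prod J) (J.prod 𝓘(ℝ, F →L[ℝ] ℝ)) ∞
    (fun q : P × S => Bundle.TotalSpace.mk' (F →L[ℝ] ℝ)
      (E := fun x : S => TangentSpace J x →L[ℝ] Bundle.Trivial S ℝ x) q.2 (β q.1 q.2))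

/-- Smoothness of a 2-cochain on the current group: it maps smooth finite-dimensional families to
smooth families. -/
def IsSmoothCochain (c : CurrentGroup I G J S → CurrentGroup I G J S → OneForm J S) : Prop :=
  ∀ (n : ℕ) (γ η : EuclideanSpace ℝ (Fin n) → CurrentGroup I G J S),
    IsSmoothFamily γ → IsSmoothFamily η → IsSmoothFormFamily (fun p => c (γ p) (η p))

/-- `γ` is a smooth curve in `C^∞(S, G)` with `γ_0 = 1` and velocity `u ∈ C^∞(S, 𝔤)` at `0`, for
instance `γ_t = exp (t u)`. -/
structure IsCurveWithVelocity (γ : ℝ → CurrentGroup I G J S) (u : CurrentAlgebra I G J S) :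
    Prop where
  smooth : IsSmoothFamily γ
  zero : γ 0 = 1
  velocity : ∀ x : S, (mfderiv 𝓘(ℝ, ℝ) I (fun t : ℝ => γ t x) 0 :
      TangentSpace 𝓘(ℝ, ℝ) (0 : ℝ) →L[ℝ] GroupLieAlgebra I G) (1 : ℝ) = u.1 x

/-- `σ` is the Lie algebra 2-cocycle associated with the (smooth) group 2-cocycle `c`:
`σ(u, v) = ∂²/∂s∂t (c(γ_s, η_t) - c(η_t, γ_s))` at `s = t = 0`, for all smooth curves `γ`, `η`
in `C^∞(S, G)` through `1` with velocities `u`, `v`. -/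
def IsAssociated (c : CurrentGroup I G J S → CurrentGroup I G J S → OneForm J S)
    (σ : CurrentAlgebra I G J S → CurrentAlgebra I G J S → OneForm J S) : Prop :=
  ∀ (u v : CurrentAlgebra I G J S) (γ η : ℝ → CurrentGroup I G J S),
    IsCurveWithVelocity γ u → IsCurveWithVelocity η v →
    ∀ (x : S) (w : TangentSpace J x),
      HasDerivAt (fun s : ℝ => deriv (fun t : ℝ => c (γ s) (η t) x w - c (η t) (γ s) x w) 0)
        (σ u v x w) 0

variable (I G J S) in
/-- `Ω¹(S)` as a trivial module over the current algebra. -/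
abbrev TrivialOneForm : Type _ := TrivialLieModule ℝ (CurrentAlgebra I G J S) (OneForm J S)

variable (I G J S) in
/-- The identification of the trivial module `Ω¹(S)` with `Ω¹(S)`. -/
abbrev toOneForm : TrivialOneForm I G J S ≃ₗ[ℝ] OneForm J S :=
  TrivialLieModule.equiv ℝ (CurrentAlgebra I G J S) (OneForm J S)

end Current

end CurrentCocycle

end

open scoped Manifold ContDiff

noncomputable section

namespace CurrentCocycle

section ModelDeriv

variable {F : Type*} [NormedAddCommGroup F] [NormedSpace ℝ F]
  {H' : Type*} [TopologicalSpace H'] {J : ModelWithCorners ℝ F H'}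
  {S : Type*} [TopologicalSpace S] [ChartedSpace H' S]
  {E : Type*} [NormedAddCommGroup E] [NormedSpace ℝ E]
  {H : Type*} [TopologicalSpace H] {I : ModelWithCorners ℝ E H}
  {M : Type*} [TopologicalSpace M] [ChartedSpace H M]
  {E₂ : Type*} [NormedAddCommGroup E₂] [NormedSpace ℝ E₂]
  {H₂ : Type*} [TopologicalSpace H₂] {K : ModelWithCorners ℝ E₂ H₂}
  {N : Type*} [TopologicalSpace N] [ChartedSpace H₂ N]
  {E₃ : Type*} [NormedAddCommGroup E₃] [NormedSpace ℝ E₃]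

variable (J I) in
/-- The derivative of a map between manifolds, as a map between the model spaces (of which all
tangent spaces are copies). -/
def modelDeriv (f : S → M) (x : S) : F →L[ℝ] E := mfderiv J I f x

theorem modelDeriv_comp {g : M → N} {f : S → M} {x : S} {y : M}
    (hg : MDifferentiableAt I K g y) (hf : MDifferentiableAt J I f x) (hy : f x = y) :
    modelDeriv J K (fun z => g (f z)) x = modelDeriv I K g y ∘L modelDeriv J I f x := by
  subst hy
  exact mfderiv_comp x hg hf

theorem modelDeriv_const (c : M) (x : S) : modelDeriv J I (fun _ => c) x = 0 :=
  mfderiv_const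

theorem modelDeriv_id (x : S) : modelDeriv J J (fun y => y) x = ContinuousLinearMap.id ℝ F :=
  mfderiv_id

theorem modelDeriv_prodMk {f : S → M} {g : S → N} {x : S}
    (hf : MDifferentiableAt J I f x) (hg : MDifferentiableAt J K g x) :
    modelDeriv J (I.prod K) (fun z => (f z, g z)) x =
      (modelDeriv J I f x).prod (modelDeriv J K g x) :=
  mfderiv_prodMk hf hg

theorem modelDeriv_eq_fderivWithin {f : S → M} {x : S} {b : M} (hf : MDifferentiableAt J I f x)
    (hb : f x = b) :
    modelDeriv J I f x = fderivWithin ℝ (extChartAt I b ∘ f ∘ (extChartAt J x).symm)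
      (Set.range J) (extChartAt J x x) := by
  subst hb
  exact hf.mfderiv

theorem modelDeriv_eq_fderiv [J.Boundaryless] {f : S → M} {x : S} {b : M}
    (hf : MDifferentiableAt J I f x) (hb : f x = b) :
    modelDeriv J I f x = fderiv ℝ (extChartAt I b ∘ f ∘ (extChartAt J x).symm)
      (extChartAt J x x) := by
  rw [modelDeriv_eq_fderivWithin hf hb, J.range_eq_univ, fderivWithin_univ]

theorem modelDeriv_bilin (B : E →L[ℝ] E₂ →L[ℝ] E₃) {u : S → E} {v : S → E₂} {x : S}
    (hu : MDifferentiableAt J 𝓘(ℝ, E) u x) (hv : MDifferentiableAt J 𝓘(ℝ, E₂) v x) (w : F) :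
    modelDeriv J 𝓘(ℝ, E₃) (fun y => B (u y) (v y)) x w =
      B (modelDeriv J 𝓘(ℝ, E) u x w) (v x) + B (u x) (modelDeriv J 𝓘(ℝ, E₂) v x w) := by
  have hB := (B.isBoundedBilinearMap.hasFDerivAt (u x, v x))
  have h := modelDeriv_comp (K := 𝓘(ℝ, E₃)) (g := fun q : E × E₂ => B q.1 q.2)
    hB.differentiableAt.mdifferentiableAt (hu.prodMk_space hv) rfl
  have h2 : modelDeriv J 𝓘(ℝ, E × E₂) (fun y => (u y, v y)) x =
      (modelDeriv J 𝓘(ℝ, E) u x).prod (modelDeriv J 𝓘(ℝ, E₂) v x) := by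
    rw [← modelDeriv_prodMk hu hv, modelWithCornersSelf_prod, ← chartedSpaceSelf_prod]
  have h3 : modelDeriv 𝓘(ℝ, E × E₂) 𝓘(ℝ, E₃) (fun q : E × E₂ => B q.1 q.2) (u x, v x) =
      B.isBoundedBilinearMap.deriv (u x, v x) := by
    rw [← hB.fderiv]; exact mfderiv_eq_fderiv
  rw [h, h2, h3]
  simp [add_comm]

theorem modelDeriv_clm_comp (L : E →L[ℝ] E₂) {u : S → E} {x : S}
    (hu : MDifferentiableAt J 𝓘(ℝ, E) u x) :
    modelDeriv J 𝓘(ℝ, E₂) (fun y => L (u y)) x = L ∘L modelDeriv J 𝓘(ℝ, E) u x := by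
  rw [modelDeriv_comp L.mdifferentiableAt hu rfl]
  congr 1
  exact L.mfderiv_eq

theorem modelDeriv_add {u v : S → E} {x : S}
    (hu : MDifferentiableAt J 𝓘(ℝ, E) u x) (hv : MDifferentiableAt J 𝓘(ℝ, E) v x) :
    modelDeriv J 𝓘(ℝ, E) (fun y => u y + v y) x =
      modelDeriv J 𝓘(ℝ, E) u x + modelDeriv J 𝓘(ℝ, E) v x :=
  mfderiv_add hu hv

theorem hasDerivAt_of_mdifferentiableAt {f : ℝ → E} {t : ℝ}
    (hf : MDifferentiableAt 𝓘(ℝ, ℝ) 𝓘(ℝ, E) f t) :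
    HasDerivAt f (modelDeriv 𝓘(ℝ, ℝ) 𝓘(ℝ, E) f t 1) t := by
  have h : modelDeriv 𝓘(ℝ, ℝ) 𝓘(ℝ, E) f t = fderiv ℝ f t := mfderiv_eq_fderiv
  rw [h]
  exact hf.differentiableAt.hasFDerivAt.hasDerivAt

/-- Mixed partial derivatives: if `f t x = b` for all `t` and `f 0` is constantly `b`, then the
derivative in `t` at `0` of the derivative of `f t` at `x` is the derivative of the velocity. -/
theorem hasDerivAt_modelDeriv [IsManifold J ∞ S] [J.Boundaryless] [IsManifold I ∞ M]
    {f : ℝ → S → M} {b : M} {x : S} {v : S → E}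
    (hf : ContMDiff (𝓘(ℝ, ℝ).prod J) I ∞ (fun q : ℝ × S => f q.1 q.2))
    (h0 : ∀ y, f 0 y = b) (hx : ∀ t, f t x = b)
    (hv : ∀ y, modelDeriv 𝓘(ℝ, ℝ) I (fun t => f t y) 0 1 = v y)
    (hvd : MDifferentiableAt J 𝓘(ℝ, E) v x) (w : F) :
    HasDerivAt (fun t => modelDeriv J I (f t) x w) (modelDeriv J 𝓘(ℝ, E) v x w) 0 := by
  set ψ := extChartAt J x with hψ
  set k : ℝ × F → E := fun q => extChartAt I b (f q.1 (ψ.symm q.2)) with hk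
  have hψx : ψ.symm (ψ x) = x := extChartAt_to_inv x
  have hψs : ContMDiffAt 𝓘(ℝ, F) J ∞ ψ.symm (ψ x) :=
    (contMDiffOn_extChartAt_symm x).contMDiffAt (extChartAt_target_mem_nhds x)
  have hkc : ContDiffAt ℝ ∞ k (0, ψ x) := by
    have h1 : ContMDiffAt (𝓘(ℝ, ℝ).prod 𝓘(ℝ, F)) J ∞ (fun q : ℝ × F => ψ.symm q.2) (0, ψ x) :=
      ContMDiffAt.comp (0, ψ x) (g := ψ.symm) hψs contMDiffAt_snd
    have h2 : ContMDiffAt (𝓘(ℝ, ℝ).prod 𝓘(ℝ, F)) (𝓘(ℝ, ℝ).prod J) ∞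
        (fun q : ℝ × F => (q.1, ψ.symm q.2)) (0, ψ x) := contMDiffAt_fst.prodMk h1
    have h3 : ContMDiffAt (𝓘(ℝ, ℝ).prod 𝓘(ℝ, F)) I ∞
        (fun q : ℝ × F => f q.1 (ψ.symm q.2)) (0, ψ x) :=
      ContMDiffAt.comp (0, ψ x) (hf _) h2
    have h4 : ContMDiffAt (𝓘(ℝ, ℝ).prod 𝓘(ℝ, F)) 𝓘(ℝ, E) ∞ k (0, ψ x) :=
      ContMDiffAt.comp (0, ψ x) (g := extChartAt I b)
        (contMDiffAt_extChartAt' (by simp [h0])) h3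
    rw [← modelWithCornersSelf_prod, chartedSpaceSelf_prod] at h4
    exact h4.contDiffAt
  have hkd : ∀ᶠ q in nhds ((0 : ℝ), ψ x), DifferentiableAt ℝ k q := by
    have := (hkc.of_le (m := 1) (by simp)).eventually (by simp)
    exact this.mono fun q hq => hq.differentiableAt one_ne_zero
  have hfd : DifferentiableAt ℝ (fderiv ℝ k) (0, ψ x) :=
    (hkc.fderiv_right (m := 1) (by norm_cast)).differentiableAt one_ne_zero
  have hsymm := hkc.isSymmSndFDerivAt (by simp [minSmoothness_of_isRCLikeNormedField]; norm_cast)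
  have hspace : ∀ᶠ t in nhds (0 : ℝ), modelDeriv J I (f t) x w = fderiv ℝ k (t, ψ x) (0, w) := by
    have hc : Filter.Tendsto (fun t : ℝ => (t, ψ x)) (nhds 0) (nhds (0, ψ x)) :=
      (Continuous.prodMk_left (ψ x)).tendsto 0
    filter_upwards [hc.eventually hkd] with t ht
    have hm : MDifferentiableAt J I (f t) x :=
      (hf.comp (contMDiff_const.prodMk contMDiff_id : ContMDiff J (𝓘(ℝ, ℝ).prod J) ∞
        (fun y : S => (t, y)))).mdifferentiableAt (by simp)
    rw [modelDeriv_eq_fderiv hm (hx t)]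
    have := ht.hasFDerivAt.comp (ψ x) (hasFDerivAt_prodMk_right t (ψ x))
    exact congrArg (· w) this.fderiv
  have htime : ∀ᶠ z in nhds (ψ x), v (ψ.symm z) = fderiv ℝ k (0, z) (1, 0) := by
    have hc : Filter.Tendsto (fun z : F => ((0 : ℝ), z)) (nhds (ψ x)) (nhds (0, ψ x)) :=
      (Continuous.prodMk_right (0 : ℝ)).tendsto _
    filter_upwards [hc.eventually hkd] with z hz
    have hm : MDifferentiableAt 𝓘(ℝ, ℝ) I (fun t => f t (ψ.symm z)) 0 :=
      (hf.comp (contMDiff_id.prodMk contMDiff_const : ContMDiff 𝓘(ℝ, ℝ) (𝓘(ℝ, ℝ).prod J) ∞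
        (fun t : ℝ => (t, ψ.symm z)))).mdifferentiableAt (by simp)
    rw [← hv, modelDeriv_eq_fderiv hm (h0 _)]
    have := HasFDerivAt.comp (0 : ℝ) (f := fun t => (t, z)) hz.hasFDerivAt
      (hasFDerivAt_prodMk_left (0 : ℝ) z)
    exact congrArg (· (1 : ℝ)) this.fderiv
  have hd : HasDerivAt (fun t => fderiv ℝ k (t, ψ x) (0, w))
      (fderiv ℝ (fderiv ℝ k) (0, ψ x) (1, 0) (0, w)) 0 := by
    have h1 : HasDerivAt (fun t : ℝ => (t, ψ x)) ((1 : ℝ), (0 : F)) 0 :=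
      (hasDerivAt_id 0).prodMk (hasDerivAt_const 0 (ψ x))
    have h2 := HasFDerivAt.comp_hasDerivAt (0 : ℝ) hfd.hasFDerivAt h1
    simpa using h2.clm_apply (hasDerivAt_const (0 : ℝ) ((0 : ℝ), w))
  have hval : modelDeriv J 𝓘(ℝ, E) v x w = fderiv ℝ (fderiv ℝ k) (0, ψ x) (1, 0) (0, w) := by
    rw [hsymm, modelDeriv_eq_fderiv hvd rfl]
    have h1 : (extChartAt 𝓘(ℝ, E) (v x) ∘ v ∘ (extChartAt J x).symm) =ᶠ[nhds (ψ x)]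
        fun z => fderiv ℝ k (0, z) (1, 0) := by
      filter_upwards [htime] with z hz
      exact hz
    rw [h1.fderiv_eq]
    have h2 := HasFDerivAt.comp (ψ x) (f := fun z : F => ((0 : ℝ), z)) hfd.hasFDerivAt
      (hasFDerivAt_prodMk_right (0 : ℝ) (ψ x))
    have h3 := h2.clm_apply (hasFDerivAt_const ((1 : ℝ), (0 : F)) (ψ x))
    refine (congrArg (· w) h3.fderiv).trans ?_
    simp
  rw [hval]
  exact hd.congr_of_eventuallyEq hspace

end ModelDeriv

section LieGroupCalculus

variable {E : Type*} [NormedAddCommGroup E] [NormedSpace ℝ E]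
  {H : Type*} [TopologicalSpace H] {I : ModelWithCorners ℝ E H}
  {G : Type*} [TopologicalSpace G] [ChartedSpace H G] [Group G] [LieGroup I ∞ G]
  {F : Type*} [NormedAddCommGroup F] [NormedSpace ℝ F]
  {H' : Type*} [TopologicalSpace H'] {J : ModelWithCorners ℝ F H'}
  {S : Type*} [TopologicalSpace S] [ChartedSpace H' S]

theorem mdifferentiableAt_mul_right (a g : G) : MDifferentiableAt I I (fun h => h * a) g :=
  (contMDiff_mul_right (I := I) (n := ∞) (a := a)).mdifferentiableAt (by simp)

theorem mdifferentiableAt_conj (g h : G) : MDifferentiableAt I I (fun h => g * h * g⁻¹) h :=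
  ((contMDiff_mul_right (I := I) (n := ∞) (a := g⁻¹)).comp
    (contMDiff_mul_left (I := I) (n := ∞) (a := g))).mdifferentiableAt (by simp)

/-- Product rule at a point where both factors are `1`. -/
theorem modelDeriv_mul {f g : S → G} {x : S} (hf : MDifferentiableAt J I f x)
    (hg : MDifferentiableAt J I g x) (hfx : f x = 1) (hgx : g x = 1) :
    modelDeriv J I (fun y => f y * g y) x = modelDeriv J I f x + modelDeriv J I g x := by
  have hm : MDifferentiableAt (I.prod I) I (fun p : G × G => p.1 * p.2) ((1, 1) : G × G) :=
    (contMDiff_mul I ∞).mdifferentiableAt (by simp)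
  have h := modelDeriv_comp (g := fun p : G × G => p.1 * p.2) hm (hf.prodMk hg)
    (by rw [hfx, hgx])
  rw [h, modelDeriv_prodMk hf hg]
  ext w
  refine (mfderiv_prod_eq_add_apply hm).trans ?_
  have h1 : modelDeriv I I (fun z : G => z * 1) 1 = ContinuousLinearMap.id ℝ E := by
    simpa only [mul_one] using modelDeriv_id (J := I) (1 : G)
  have h2 : modelDeriv I I (fun z : G => 1 * z) 1 = ContinuousLinearMap.id ℝ E := by
    simpa only [one_mul] using modelDeriv_id (J := I) (1 : G)
  exact congrArg₂ (fun A B : E →L[ℝ] E => A (modelDeriv J I f x w) + B (modelDeriv J I g x w))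
    h1 h2

theorem ad_mul (g h : G) : Ad I (g * h) = Ad I g ∘L Ad I h := by
  have h1 := modelDeriv_comp (K := I) (g := fun k : G => g * k * g⁻¹)
    (mdifferentiableAt_conj (I := I) g 1) (mdifferentiableAt_conj (I := I) h 1) (by simp)
  refine Eq.trans ?_ h1
  change modelDeriv I I _ _ = _
  congr 1
  ext k
  group

omit [LieGroup I ∞ G] in
theorem ad_one : Ad I (1 : G) = ContinuousLinearMap.id ℝ (GroupLieAlgebra I G) := by
  refine Eq.trans ?_ (modelDeriv_id (J := I) (1 : G))
  change modelDeriv I I _ _ = _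
  congr 1
  ext k
  group

theorem rightLogDeriv_eq (g : CurrentGroup I G J S) (x : S) :
    rightLogDeriv g x = modelDeriv J I (fun y => g y * (g x)⁻¹) x :=
  (modelDeriv_comp (g := fun h : G => h * (g x)⁻¹) (mdifferentiableAt_mul_right _ _)
    (g.contMDiff.mdifferentiableAt (by simp)) rfl).symm

theorem rightLogDeriv_mul (g h : CurrentGroup I G J S) (x : S) (w : TangentSpace J x) :
    rightLogDeriv (g * h) x w = rightLogDeriv g x w + Ad I (g x) (rightLogDeriv h x w) := by
  have hd : ∀ k : CurrentGroup I G J S,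
      MDifferentiableAt J I (fun y => k y * (k x)⁻¹) x := fun k =>
    (k.contMDiff.mul contMDiff_const).mdifferentiableAt (by simp)
  have hc : MDifferentiableAt J I (fun y => g x * (h y * (h x)⁻¹) * (g x)⁻¹) x :=
    ((contMDiff_const.mul (h.contMDiff.mul contMDiff_const)).mul
      contMDiff_const).mdifferentiableAt (by simp)
  have h1 := modelDeriv_mul (hd g) hc (by simp) (by simp)
  have h2 := modelDeriv_comp (K := I) (g := fun k : G => g x * k * (g x)⁻¹)
    (mdifferentiableAt_conj (I := I) (g x) 1) (hd h) (by simp)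
  have h3 : (fun y => (g * h) y * ((g * h) x)⁻¹) =
      fun y => g y * (g x)⁻¹ * (g x * (h y * (h x)⁻¹) * (g x)⁻¹) := by
    ext y
    simp only [ContMDiffMap.coe_mul, Pi.mul_apply]
    group
  rw [rightLogDeriv_eq, rightLogDeriv_eq, rightLogDeriv_eq, h3, h1, h2]
  rfl

end LieGroupCalculus

section Trivialization

variable {F : Type*} [NormedAddCommGroup F] [NormedSpace ℝ F]
  {H' : Type*} [TopologicalSpace H'] {J : ModelWithCorners ℝ F H'}
  {S : Type*} [TopologicalSpace S] [ChartedSpace H' S] [IsManifold J ∞ S]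

theorem continuousLinearMapAt_trivializationAt_self (x : S) :
    (trivializationAt F (TangentSpace J) x).continuousLinearMapAt ℝ x =
      ContinuousLinearMap.id ℝ F := by
  rw [TangentBundle.continuousLinearMapAt_trivializationAt_eq_core (mem_chart_source H' x)]
  ext w
  exact (tangentBundleCore J S).coordChange_self _ _ (mem_chart_source H' x) w

theorem symmL_trivializationAt_self (x : S) :
    (trivializationAt F (TangentSpace J) x).symmL ℝ x = ContinuousLinearMap.id ℝ F := by
  rw [TangentBundle.symmL_trivializationAt_eq_core (mem_chart_source H' x)]
  ext w
  exact (tangentBundleCore J S).coordChange_self _ _ (mem_chart_source H' x) w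

variable {E : Type*} [NormedAddCommGroup E] [NormedSpace ℝ E]
  {H : Type*} [TopologicalSpace H] {I : ModelWithCorners ℝ E H}
  {M : Type*} [TopologicalSpace M] [ChartedSpace H M] [IsManifold I ∞ M]
  {E₂ : Type*} [NormedAddCommGroup E₂] [NormedSpace ℝ E₂]
  {H₂ : Type*} [TopologicalSpace H₂] {K : ModelWithCorners ℝ E₂ H₂}
  {N : Type*} [TopologicalSpace N] [ChartedSpace H₂ N]

/-- A parametrised derivative, taken where the map has a fixed value, is smooth when read in a
chart of the source. -/
theorem contMDiffAt_modelDeriv_comp_symmL [IsManifold K ∞ N] {f : N → S → M} {g : N → S} {b : M}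
    (hf : ContMDiff (K.prod J) I ∞ (fun q : N × S => f q.1 q.2)) (hg : ContMDiff K J ∞ g)
    (hb : ∀ q, f q (g q) = b) (q₀ : N) :
    ContMDiffAt K 𝓘(ℝ, F →L[ℝ] E) ∞ (fun q => modelDeriv J I (f q) (g q) ∘L
      (trivializationAt F (TangentSpace J) (g q₀)).symmL ℝ (g q)) q₀ := by
  have h := ContMDiffAt.mfderiv (x₀ := q₀) (m := ∞) f g (hf _) (hg _) (by simp)
  refine h.congr_of_eventuallyEq (Filter.Eventually.of_forall fun q => ?_)
  have key : ∀ (b₀ b₁ : M), b₀ = b → b₁ = b → ∀ φ : F →L[ℝ] E,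
      φ ∘L ((trivializationAt F (TangentSpace J) (g q₀)).symmL ℝ (g q) : F →L[ℝ] F) =
        ContinuousLinearMap.inCoordinates F (TangentSpace J) E (TangentSpace I)
        (g q₀) (g q) b₀ b₁ φ := by
    intro b₀ b₁ h₀ h₁ φ
    rw [h₀, h₁]
    exact (congrArg (fun T : E →L[ℝ] E => T ∘L φ ∘L
      ((trivializationAt F (TangentSpace J) (g q₀)).symmL ℝ (g q) : F →L[ℝ] F))
      (continuousLinearMapAt_trivializationAt_self b)).symm
  exact key _ _ (hb q₀) (hb q) _

end Trivialization

section Adjoint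

variable {E : Type*} [NormedAddCommGroup E] [NormedSpace ℝ E]
  {H : Type*} [TopologicalSpace H] {I : ModelWithCorners ℝ E H}
  {G : Type*} [TopologicalSpace G] [ChartedSpace H G] [Group G] [LieGroup I ∞ G]

theorem contMDiff_ad :
    ContMDiff I 𝓘(ℝ, E →L[ℝ] E) ∞ (M' := E →L[ℝ] E) (fun g : G => Ad I g) := by
  intro g₀
  have h := contMDiffAt_modelDeriv_comp_symmL (K := I) (J := I) (I := I)
    (f := fun g h : G => g * h * g⁻¹) (g := fun _ => (1 : G)) (b := 1)
    ((contMDiff_fst.mul contMDiff_snd).mul contMDiff_fst.inv) contMDiff_const (by simp) g₀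
  refine h.congr_of_eventuallyEq (Filter.Eventually.of_forall fun g => ?_)
  exact (congrArg (fun T : E →L[ℝ] E => modelDeriv I I (fun h : G => g * h * g⁻¹) 1 ∘L T)
    (symmL_trivializationAt_self (1 : G))).symm

end Adjoint

section Pairing

variable {E : Type*} [NormedAddCommGroup E] [NormedSpace ℝ E] [FiniteDimensional ℝ E]
  {F : Type*} [NormedAddCommGroup F] [NormedSpace ℝ F]
  {H' : Type*} [TopologicalSpace H'] {J : ModelWithCorners ℝ F H'}
  {S : Type*} [TopologicalSpace S] [ChartedSpace H' S] [IsManifold J ∞ S]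
  {E₂ : Type*} [NormedAddCommGroup E₂] [NormedSpace ℝ E₂]
  {H₂ : Type*} [TopologicalSpace H₂] {K : ModelWithCorners ℝ E₂ H₂}
  {N : Type*} [TopologicalSpace N] [ChartedSpace H₂ N]

omit [IsManifold J ∞ S] in
theorem contMDiff_toContinuousLinearMap {A : S → Module.Dual ℝ E}
    (hA : ∀ y, ContMDiff J 𝓘(ℝ, ℝ) ∞ (fun q => A q y)) :
    ContMDiff J 𝓘(ℝ, E →L[ℝ] ℝ) ∞ (fun q => LinearMap.toContinuousLinearMap (A q)) := by
  set b := Module.finBasis ℝ E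
  have h : (fun q => LinearMap.toContinuousLinearMap (A q)) =
      fun q => ∑ i, A q (b i) • LinearMap.toContinuousLinearMap (b.coord i) := by
    funext q
    ext y
    have hy := congrArg (A q) (b.sum_repr y)
    simp only [map_sum, map_smul, smul_eq_mul] at hy
    simp [← hy, mul_comm]
  rw [h]
  exact contMDiff_finsetSum fun i _ => (hA (b i)).smul contMDiff_const

/-- The 1-forms obtained by pairing smooth functionals with smooth `E`-valued 1-forms depend
smoothly on parameters. -/
theorem contMDiff_pairing {A : N → Module.Dual ℝ E} {g : N → S} {Φ : N → F →L[ℝ] E}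
    (hA : ∀ y, ContMDiff K 𝓘(ℝ, ℝ) ∞ (fun q => A q y)) (hg : ContMDiff K J ∞ g)
    (hΦ : ∀ q₀, ContMDiffAt K 𝓘(ℝ, F →L[ℝ] E) ∞
      (fun q => Φ q ∘L (trivializationAt F (TangentSpace J) (g q₀)).symmL ℝ (g q)) q₀) :
    ContMDiff K (J.prod 𝓘(ℝ, F →L[ℝ] ℝ)) ∞ (fun q => Bundle.TotalSpace.mk' (F →L[ℝ] ℝ)
      (E := fun x : S => TangentSpace J x →L[ℝ] Bundle.Trivial S ℝ x) (g q)
      (LinearMap.toContinuousLinearMap (A q) ∘L Φ q)) := by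
  intro q₀
  refine (contMDiffAt_hom_bundle _).2 ⟨hg q₀, ?_⟩
  refine ((contMDiff_toContinuousLinearMap hA q₀).clm_comp (hΦ q₀)).congr_of_eventuallyEq
    (Filter.Eventually.of_forall fun q => ?_)
  exact congrArg (fun T : ℝ →L[ℝ] ℝ => T ∘L (LinearMap.toContinuousLinearMap (A q) ∘L Φ q) ∘L
      ((trivializationAt F (TangentSpace J) (g q₀)).symmL ℝ (g q) : F →L[ℝ] F))
      (Bundle.Trivial.continuousLinearMapAt_trivialization ℝ S ℝ (g q))

end Pairing

section GroupCocycle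

variable {E : Type*} [NormedAddCommGroup E] [NormedSpace ℝ E] [FiniteDimensional ℝ E]
  {H : Type*} [TopologicalSpace H] {I : ModelWithCorners ℝ E H}
  {G : Type*} [TopologicalSpace G] [ChartedSpace H G] [Group G]

/-- A linear functional on `𝔤`, as a continuous linear functional on the model space of `𝔤`. -/
def dualToModel (l : Module.Dual ℝ (GroupLieAlgebra I G)) : E →L[ℝ] ℝ :=
  LinearMap.toContinuousLinearMap (show E →ₗ[ℝ] ℝ from l)

variable [LieGroup I ∞ G]
  {F : Type*} [NormedAddCommGroup F] [NormedSpace ℝ F]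
  {H' : Type*} [TopologicalSpace H'] {J : ModelWithCorners ℝ F H'}
  {S : Type*} [TopologicalSpace S] [ChartedSpace H' S] [IsManifold J ∞ S]

/-- The right logarithmic derivative as a map between the model spaces. -/
def rightLogDerivModel (g : CurrentGroup I G J S) (x : S) : F →L[ℝ] E := rightLogDeriv g x

omit [FiniteDimensional ℝ E] in
/-- Right logarithmic derivatives of smooth families are smooth in charts. -/
theorem contMDiffAt_rightLogDeriv {P : Type*} [NormedAddCommGroup P] [NormedSpace ℝ P]
    {η : P → CurrentGroup I G J S} (hη : IsSmoothFamily η) (q₀ : P × S) :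
    ContMDiffAt (𝓘(ℝ, P).prod J) 𝓘(ℝ, F →L[ℝ] E) ∞
      (fun q : P × S => rightLogDerivModel (η q.1) q.2 ∘L
        (trivializationAt F (TangentSpace J) q₀.2).symmL ℝ q.2) q₀ := by
  have hf : ContMDiff ((𝓘(ℝ, P).prod J).prod J) I ∞
      (fun r : (P × S) × S => η r.1.1 r.2 * (η r.1.1 r.1.2)⁻¹) :=
    (ContMDiff.comp (g := fun q : P × S => η q.1 q.2) hη
        ((contMDiff_fst.comp contMDiff_fst).prodMk contMDiff_snd)).mul
      (ContMDiff.comp (g := fun q : P × S => η q.1 q.2) hη contMDiff_fst).inv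
  have h := contMDiffAt_modelDeriv_comp_symmL (b := (1 : G))
    (f := fun (q : P × S) y => η q.1 y * (η q.1 q.2)⁻¹) hf contMDiff_snd (by simp) q₀
  refine h.congr_of_eventuallyEq (Filter.Eventually.of_forall fun q => ?_)
  exact congrArg (fun T : F →L[ℝ] E => T ∘L
    ((trivializationAt F (TangentSpace J) q₀.2).symmL ℝ q.2 : F →L[ℝ] F))
    (rightLogDeriv_eq (η q.1) q.2)

theorem contMDiff_pairing_rightLogDeriv {P : Type*} [NormedAddCommGroup P] [NormedSpace ℝ P]
    {A : G → Module.Dual ℝ (GroupLieAlgebra I G)}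
    (hA : ∀ y, ContMDiff I 𝓘(ℝ, ℝ) ∞ (fun g => A g y))
    {γ η : P → CurrentGroup I G J S} (hγ : IsSmoothFamily γ) (hη : IsSmoothFamily η) :
    ContMDiff (𝓘(ℝ, P).prod J) (J.prod 𝓘(ℝ, F →L[ℝ] ℝ)) ∞
      (fun q : P × S => Bundle.TotalSpace.mk' (F →L[ℝ] ℝ)
        (E := fun x : S => TangentSpace J x →L[ℝ] Bundle.Trivial S ℝ x) q.2
        (dualToModel (A (γ q.1 q.2)) ∘L rightLogDerivModel (η q.1) q.2 : F →L[ℝ] ℝ)) :=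
  contMDiff_pairing (E := E) (A := fun q : P × S => (show E →ₗ[ℝ] ℝ from A (γ q.1 q.2)))
    (fun y => ContMDiff.comp (g := fun g => A g y) (hA y) hγ)
    contMDiff_snd (contMDiffAt_rightLogDeriv hη)

/-- The 2-cochain `(g₁, g₂) ↦ A(g₁)(dg₂ g₂⁻¹)` on the current group. -/
def pairingCochain (A : G → Module.Dual ℝ (GroupLieAlgebra I G))
    (hA : ∀ y, ContMDiff I 𝓘(ℝ, ℝ) ∞ (fun g => A g y))
    (g₁ g₂ : CurrentGroup I G J S) : OneForm J S where
  toFun x := (dualToModel (A (g₁ x)) ∘L rightLogDerivModel g₂ x : F →L[ℝ] ℝ)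
  contMDiff_toFun :=
    (contMDiff_pairing_rightLogDeriv (P := ℝ) hA (γ := fun _ => g₁) (η := fun _ => g₂)
      (g₁.contMDiff.comp contMDiff_snd) (g₂.contMDiff.comp contMDiff_snd)).comp
      ((contMDiff_const (c := (0 : ℝ))).prodMk contMDiff_id)

theorem pairingCochain_apply (A : G → Module.Dual ℝ (GroupLieAlgebra I G))
    (hA : ∀ y, ContMDiff I 𝓘(ℝ, ℝ) ∞ (fun g => A g y))
    (g₁ g₂ : CurrentGroup I G J S) (x : S) (w : TangentSpace J x) :
    pairingCochain A hA g₁ g₂ x w = A (g₁ x) (rightLogDeriv g₂ x w) := rfl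

theorem isSmoothCochain_pairingCochain (A : G → Module.Dual ℝ (GroupLieAlgebra I G))
    (hA : ∀ y, ContMDiff I 𝓘(ℝ, ℝ) ∞ (fun g => A g y)) :
    IsSmoothCochain (pairingCochain (J := J) (S := S) A hA) :=
  fun _ _ _ hγ hη => contMDiff_pairing_rightLogDeriv hA hγ hη

theorem IsRightOneCocycle.isGroupTwoCocycle {A : G → Module.Dual ℝ (GroupLieAlgebra I G)}
    (h : IsRightOneCocycle A) (hA : ∀ y, ContMDiff I 𝓘(ℝ, ℝ) ∞ (fun g => A g y)) :
    IsGroupTwoCocycle (pairingCochain (J := J) (S := S) A hA) := by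
  intro g₁ g₂ g₃
  refine ContMDiffSection.ext fun x => ContinuousLinearMap.ext fun w => ?_
  change A (g₂ x) (rightLogDeriv g₃ x w) - A ((g₁ * g₂) x) (rightLogDeriv g₃ x w)
    + A (g₁ x) (rightLogDeriv (g₂ * g₃) x w) - A (g₁ x) (rightLogDeriv g₂ x w) = 0
  have h12 : (g₁ * g₂) x = g₁ x * g₂ x := rfl
  have h3 : coadjoint (I := I) (g₂ x)⁻¹ (A (g₁ x)) (rightLogDeriv g₃ x w) =
      A (g₁ x) (Ad I (g₂ x) (rightLogDeriv g₃ x w)) := by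
    simp [coadjoint]
  rw [rightLogDeriv_mul, h12, h (g₁ x), LinearMap.add_apply, h3, map_add]
  ring

omit [FiniteDimensional ℝ E] [LieGroup I ∞ G] in
theorem IsRightOneCocycle.map_one {A : G → Module.Dual ℝ (GroupLieAlgebra I G)}
    (h : IsRightOneCocycle A) : A 1 = 0 := by
  have h1 := h 1 1
  have h2 : coadjoint (I := I) (1 : G)⁻¹ (A 1) = A 1 := by
    ext y
    simp [coadjoint, ad_one]
  rw [h2, mul_one] at h1
  simpa using h1

omit [FiniteDimensional ℝ E] in
/-- A left 1-cocycle `a` gives the right 1-cocycle `g ↦ a g ∘ Ad g`. -/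
theorem IsLeftOneCocycle.isRightOneCocycle {a : G → Module.Dual ℝ (GroupLieAlgebra I G)}
    (h : IsLeftOneCocycle a) : IsRightOneCocycle (fun g => coadjoint g⁻¹ (a g)) := by
  intro g k
  ext y
  have hg : ∀ z, Ad I g⁻¹ (Ad I g z) = z := fun z => by
    have := congrArg (fun T => T z) (ad_mul (I := I) g⁻¹ g)
    simpa [ad_one] using this.symm
  simp [coadjoint, h g k, ad_mul, hg]
  abel

end GroupCocycle

section Derivation

variable {E : Type*} [NormedAddCommGroup E] [NormedSpace ℝ E] [FiniteDimensional ℝ E]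
  {H : Type*} [TopologicalSpace H] {I : ModelWithCorners ℝ E H}
  {G : Type*} [TopologicalSpace G] [ChartedSpace H G] [Group G] [LieGroup I ∞ G]
  {F : Type*} [NormedAddCommGroup F] [NormedSpace ℝ F]
  {H' : Type*} [TopologicalSpace H'] {J : ModelWithCorners ℝ F H'}
  {S : Type*} [TopologicalSpace S] [ChartedSpace H' S]
  {α : GroupLieAlgebra I G →ₗ[ℝ] Module.Dual ℝ (GroupLieAlgebra I G)}

/-- An element of `C^∞(S, 𝔤)` as a map to the model space. -/
def toModel (u : CurrentAlgebra I G J S) : S → E := u.1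

omit [FiniteDimensional ℝ E] [LieGroup I ∞ G] in
theorem contMDiff_toModel (u : CurrentAlgebra I G J S) : ContMDiff J 𝓘(ℝ, E) ∞ (toModel u) := u.2

omit [FiniteDimensional ℝ E] [LieGroup I ∞ G] in
theorem mdifferentiableAt_toModel (u : CurrentAlgebra I G J S) (x : S) :
    MDifferentiableAt J 𝓘(ℝ, E) (toModel u) x :=
  (contMDiff_toModel u).mdifferentiableAt (by simp)

omit [FiniteDimensional ℝ E] [LieGroup I ∞ G] in
theorem dAlg_add (u v : CurrentAlgebra I G J S) (x : S) (w : TangentSpace J x) :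
    dAlg (u + v) x w = dAlg u x w + dAlg v x w :=
  congrArg (fun T : F →L[ℝ] E => T w)
    (modelDeriv_add (mdifferentiableAt_toModel u x) (mdifferentiableAt_toModel v x))

omit [FiniteDimensional ℝ E] [LieGroup I ∞ G] in
theorem dAlg_smul (r : ℝ) (u : CurrentAlgebra I G J S) (x : S) (w : TangentSpace J x) :
    dAlg (r • u) x w = r • dAlg u x w :=
  congrArg (fun T : F →L[ℝ] E => T w)
    (modelDeriv_clm_comp (r • ContinuousLinearMap.id ℝ E) (mdifferentiableAt_toModel u x))

theorem dAlg_lie (u v : CurrentAlgebra I G J S) (x : S) (w : TangentSpace J x) :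
    dAlg ⁅u, v⁆ x w = ⁅dAlg u x w, v.1 x⁆ + ⁅u.1 x, dAlg v x w⁆ :=
  modelDeriv_bilin (LinearMap.toContinuousBilinearMap (bracketBilin I G))
    (mdifferentiableAt_toModel u x) (mdifferentiableAt_toModel v x) w

omit [LieGroup I ∞ G] in
theorem mvfderiv_skewPart (u v : CurrentAlgebra I G J S) (x : S) (w : TangentSpace J x) :
    mvfderiv J (fun y => skewPart α (u.1 y) (v.1 y)) x w =
      skewPart α (dAlg u x w) (v.1 x) + skewPart α (u.1 x) (dAlg v x w) := by
  let B : E →ₗ[ℝ] E →ₗ[ℝ] ℝ := (show E →ₗ[ℝ] E →ₗ[ℝ] ℝ from (2⁻¹ : ℝ) • (α - α.flip))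
  have hB : ∀ a b : GroupLieAlgebra I G, B a b = skewPart α a b :=
    fun a b => (div_eq_inv_mul _ _).symm
  have h := modelDeriv_bilin (LinearMap.toContinuousBilinearMap B)
    (mdifferentiableAt_toModel u x) (mdifferentiableAt_toModel v x) w
  rw [← hB, ← hB]
  refine Eq.trans ?_ h
  exact congrArg (fun f => modelDeriv J 𝓘(ℝ, ℝ) f x w) (funext fun y => (hB _ _).symm)

omit [LieGroup I ∞ G] in
/-- The Neeb form is the antisymmetrisation of `α(u)(dv)`. -/
theorem neebForm_eq (u v : CurrentAlgebra I G J S) (x : S) (w : TangentSpace J x) :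
    neebForm α u v x w = α (u.1 x) (dAlg v x w) - α (v.1 x) (dAlg u x w) := by
  rw [neebForm, mvfderiv_skewPart]
  simp only [symmPart, skewPart]
  ring

end Derivation

section NeebCocycle

variable {E : Type*} [NormedAddCommGroup E] [NormedSpace ℝ E] [FiniteDimensional ℝ E]
  {H : Type*} [TopologicalSpace H] {I : ModelWithCorners ℝ E H}
  {G : Type*} [TopologicalSpace G] [ChartedSpace H G] [Group G] [LieGroup I ∞ G]
  {F : Type*} [NormedAddCommGroup F] [NormedSpace ℝ F]
  {H' : Type*} [TopologicalSpace H'] {J : ModelWithCorners ℝ F H'}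
  {S : Type*} [TopologicalSpace S] [ChartedSpace H' S] [IsManifold J ∞ S]
  (α : GroupLieAlgebra I G →ₗ[ℝ] Module.Dual ℝ (GroupLieAlgebra I G))

omit [FiniteDimensional ℝ E] in
theorem contMDiffAt_modelDeriv_of_vectorSpace {v : S → E} (hv : ContMDiff J 𝓘(ℝ, E) ∞ v)
    (x₀ : S) : ContMDiffAt J 𝓘(ℝ, F →L[ℝ] E) ∞ (fun x => modelDeriv J 𝓘(ℝ, E) v x ∘L
      (trivializationAt F (TangentSpace J) x₀).symmL ℝ x) x₀ := by
  have h := contMDiffAt_modelDeriv_comp_symmL (K := J) (J := J) (I := 𝓘(ℝ, E)) (b := (0 : E))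
    (f := fun x y => v y + -v x) (g := fun x => x)
    ((hv.comp contMDiff_snd).add (hv.comp contMDiff_fst).neg) contMDiff_id (by simp) x₀
  refine h.congr_of_eventuallyEq (Filter.Eventually.of_forall fun x => ?_)
  simp only
  rw [modelDeriv_add (hv.mdifferentiableAt (by simp)) mdifferentiableAt_const, modelDeriv_const,
    add_zero]

/-- The 1-form `α(u)(dv)`. -/
def pairingForm (u v : CurrentAlgebra I G J S) : OneForm J S where
  toFun x := (dualToModel (α (u.1 x)) ∘L modelDeriv J 𝓘(ℝ, E) (toModel v) x : F →L[ℝ] ℝ)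
  contMDiff_toFun := by
    refine contMDiff_pairing (E := E) (A := fun x : S => (show E →ₗ[ℝ] ℝ from α (u.1 x)))
      (g := fun x => x) (fun y => ?_) contMDiff_id
      (contMDiffAt_modelDeriv_of_vectorSpace (contMDiff_toModel v))
    have h : ContMDiff 𝓘(ℝ, E) 𝓘(ℝ, ℝ) ∞ (dualToModel (α.flip y)) :=
      (dualToModel (α.flip y)).contMDiff
    exact h.comp (contMDiff_toModel u)

theorem oneForm_ext {β β' : OneForm J S} (h : ∀ x w, β x w = β' x w) : β = β' :=
  ContMDiffSection.ext fun x => ContinuousLinearMap.ext (h x)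

/-- `(u, v) ↦ α(u)(dv)` as a bilinear map. -/
def pairingBilin :
    CurrentAlgebra I G J S →ₗ[ℝ] CurrentAlgebra I G J S →ₗ[ℝ] OneForm J S :=
  LinearMap.mk₂ ℝ (pairingForm α)
    (fun u u' v => oneForm_ext fun x w => by
      change α (u.1 x + u'.1 x) (dAlg v x w) = α (u.1 x) (dAlg v x w) + α (u'.1 x) (dAlg v x w)
      rw [map_add, LinearMap.add_apply])
    (fun c u v => oneForm_ext fun x w => by
      change α (c • u.1 x) (dAlg v x w) = c • α (u.1 x) (dAlg v x w)
      rw [map_smul, LinearMap.smul_apply])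
    (fun u v v' => oneForm_ext fun x w => by
      change α (u.1 x) (dAlg (v + v') x w) = α (u.1 x) (dAlg v x w) + α (u.1 x) (dAlg v' x w)
      rw [dAlg_add, map_add])
    (fun c u v => oneForm_ext fun x w => by
      change α (u.1 x) (dAlg (c • v) x w) = c • α (u.1 x) (dAlg v x w)
      rw [dAlg_smul, map_smul])

/-- The Neeb cochain `(u, v) ↦ α(u)(dv) - α(v)(du)`. -/
def neebCochain : LieModule.Cohomology.twoCochain ℝ (CurrentAlgebra I G J S)
    (TrivialOneForm I G J S) :=
  ⟨(pairingBilin α - (pairingBilin α).flip).compr₂ (toOneForm I G J S).symm.toLinearMap,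
    fun u => by simp⟩

theorem toOneForm_neebCochain (u v : CurrentAlgebra I G J S) (x : S) (w : TangentSpace J x) :
    toOneForm I G J S (neebCochain α u v) x w =
      α (u.1 x) (dAlg v x w) - α (v.1 x) (dAlg u x w) := rfl

variable {α}

theorem cocycle_lie_apply (hα : LieModule.Cohomology.d₁₂ ℝ (GroupLieAlgebra I G)
      (Module.Dual ℝ (GroupLieAlgebra I G)) α = 0) (a b c : GroupLieAlgebra I G) :
    α ⁅a, b⁆ c = α a ⁅b, c⁆ - α b ⁅a, c⁆ := by
  have h : ⁅a, α b⁆ - ⁅b, α a⁆ - α ⁅a, b⁆ = 0 := by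
    rw [← LieModule.Cohomology.d₁₂_apply_apply, hα]
    rfl
  have h2 := congrArg (fun T => T c) h
  simp only [LinearMap.sub_apply, Module.Dual.lie_apply, LinearMap.zero_apply] at h2
  linarith

theorem cocycle_jacobi (hα : LieModule.Cohomology.d₁₂ ℝ (GroupLieAlgebra I G)
      (Module.Dual ℝ (GroupLieAlgebra I G)) α = 0) (a b c a' b' c' : GroupLieAlgebra I G) :
    α a (⁅b', c⁆ + ⁅b, c'⁆) - α ⁅b, c⁆ a' =
      α ⁅a, b⁆ c' - α c (⁅a', b⁆ + ⁅a, b'⁆) + (α b (⁅a', c⁆ + ⁅a, c'⁆) - α ⁅a, c⁆ b') := by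
  rw [cocycle_lie_apply hα, cocycle_lie_apply hα, cocycle_lie_apply hα, ← lie_skew b' c,
    ← lie_skew a' b, ← lie_skew a' c]
  simp only [map_add, map_neg]
  ring

theorem neebCochain_mem_twoCocycle (hα : LieModule.Cohomology.d₁₂ ℝ (GroupLieAlgebra I G)
      (Module.Dual ℝ (GroupLieAlgebra I G)) α = 0) :
    neebCochain (J := J) (S := S) α ∈ LieModule.Cohomology.twoCocycle ℝ
      (CurrentAlgebra I G J S) (TrivialOneForm I G J S) := by
  rw [LieModule.Cohomology.mem_twoCocycle_iff_of_trivial]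
  intro u v z
  apply (toOneForm I G J S).injective
  refine oneForm_ext fun x w => ?_
  rw [map_add]
  change _ = toOneForm I G J S (neebCochain α ⁅u, v⁆ z) x w +
    toOneForm I G J S (neebCochain α v ⁅u, z⁆) x w
  simp only [toOneForm_neebCochain, dAlg_lie]
  exact cocycle_jacobi hα _ _ _ _ _ _

end NeebCocycle

section Associated

variable {E : Type*} [NormedAddCommGroup E] [NormedSpace ℝ E] [FiniteDimensional ℝ E]
  {H : Type*} [TopologicalSpace H] {I : ModelWithCorners ℝ E H}
  {G : Type*} [TopologicalSpace G] [ChartedSpace H G] [Group G] [LieGroup I ∞ G]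
  {F : Type*} [NormedAddCommGroup F] [NormedSpace ℝ F]
  {H' : Type*} [TopologicalSpace H'] {J : ModelWithCorners ℝ F H'}
  {S : Type*} [TopologicalSpace S] [ChartedSpace H' S]

omit [FiniteDimensional ℝ E] [Group G] [LieGroup I ∞ G] in
theorem IsSmoothFamily.contMDiff_eval {P : Type*} [NormedAddCommGroup P] [NormedSpace ℝ P]
    {γ : P → CurrentGroup I G J S} (h : IsSmoothFamily γ) (x : S) :
    ContMDiff 𝓘(ℝ, P) I ∞ (fun p => γ p x) :=
  ContMDiff.comp (g := fun q : P × S => γ q.1 q.2) h (contMDiff_id.prodMk contMDiff_const)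

omit [FiniteDimensional ℝ E] [LieGroup I ∞ G] in
theorem IsCurveWithVelocity.hasDerivAt_apply {γ : ℝ → CurrentGroup I G J S}
    {u : CurrentAlgebra I G J S} (h : IsCurveWithVelocity γ u)
    {A : G → Module.Dual ℝ (GroupLieAlgebra I G)}
    {α : GroupLieAlgebra I G →ₗ[ℝ] Module.Dual ℝ (GroupLieAlgebra I G)} (hA : Integrates A α)
    (x : S) (y : GroupLieAlgebra I G) :
    HasDerivAt (fun t => A (γ t x) y) (α (u.1 x) y) 0 := by
  have hγ := (h.smooth.contMDiff_eval x).mdifferentiableAt (x := 0) (by simp)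
  have hAd := (hA.smooth y).mdifferentiableAt (x := 1) (by simp)
  have h0 : γ 0 x = 1 := by rw [h.zero]; rfl
  have hc := modelDeriv_comp hAd hγ h0
  have hd := hasDerivAt_of_mdifferentiableAt
    ((hA.smooth y).comp (h.smooth.contMDiff_eval x) |>.mdifferentiableAt (x := 0) (by simp))
  refine hd.congr_deriv ?_
  refine (congrArg (fun T : ℝ →L[ℝ] ℝ => T 1) hc).trans ?_
  rw [← hA.deriv_one, ← h.velocity x]
  rfl

omit [FiniteDimensional ℝ E] in
theorem IsCurveWithVelocity.hasDerivAt_rightLogDeriv [IsManifold J ∞ S] [J.Boundaryless]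
    {η : ℝ → CurrentGroup I G J S} {v : CurrentAlgebra I G J S} (h : IsCurveWithVelocity η v)
    (x : S) (w : TangentSpace J x) :
    HasDerivAt (F := E) (fun t => rightLogDeriv (η t) x w) (dAlg v x w) 0 := by
  have h0 : ∀ y, η 0 y = 1 := fun y => by rw [h.zero]; rfl
  have hi := (h.smooth.contMDiff_eval x).inv
  set z₀ : E := modelDeriv 𝓘(ℝ, ℝ) I (fun t => (η t x)⁻¹) 0 1 with hz₀
  have hv : ∀ y, modelDeriv 𝓘(ℝ, ℝ) I (fun t => η t y * (η t x)⁻¹) 0 1 = toModel v y + z₀ := by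
    intro y
    rw [modelDeriv_mul ((h.smooth.contMDiff_eval y).mdifferentiableAt (by simp))
      (hi.mdifferentiableAt (by simp)) (h0 y) (by rw [h0, inv_one])]
    exact congrArg (· + z₀) (h.velocity y)
  have hs : ContMDiff (𝓘(ℝ, ℝ).prod J) I ∞ (fun q : ℝ × S => η q.1 q.2 * (η q.1 x)⁻¹) :=
    ContMDiff.mul h.smooth (hi.comp contMDiff_fst)
  have hd := hasDerivAt_modelDeriv (b := (1 : G)) (x := x) hs (by simp [h0]) (by simp) hv
    ((mdifferentiableAt_toModel v x).add mdifferentiableAt_const) w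
  rw [modelDeriv_add (mdifferentiableAt_toModel v x) mdifferentiableAt_const, modelDeriv_const,
    add_zero] at hd
  refine hd.congr_of_eventuallyEq (Filter.Eventually.of_forall fun t => ?_)
  exact congrArg (fun T : F →L[ℝ] E => T w) (rightLogDeriv_eq (η t) x)

theorem isAssociated_pairingCochain [IsManifold J ∞ S] [J.Boundaryless]
    {A : G → Module.Dual ℝ (GroupLieAlgebra I G)}
    {α : GroupLieAlgebra I G →ₗ[ℝ] Module.Dual ℝ (GroupLieAlgebra I G)} (hA : Integrates A α) :
    IsAssociated (pairingCochain (J := J) (S := S) A hA.smooth)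
      (fun u v => toOneForm I G J S (neebCochain α u v)) := by
  intro u v γ η hγ hη x w
  have hlin : ∀ (l : Module.Dual ℝ (GroupLieAlgebra I G)) (ζ : ℝ → CurrentGroup I G J S)
      (z : CurrentAlgebra I G J S), IsCurveWithVelocity ζ z →
      HasDerivAt (fun t => l (rightLogDeriv (ζ t) x w)) (l (dAlg z x w)) 0 := fun l ζ z hζ =>
    (dualToModel l).hasFDerivAt.comp_hasDerivAt 0 (hζ.hasDerivAt_rightLogDeriv x w)
  have hinner : (fun s => deriv (fun t => pairingCochain A hA.smooth (γ s) (η t) x w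
      - pairingCochain A hA.smooth (η t) (γ s) x w) 0) =
      fun s => A (γ s x) (dAlg v x w) - α (v.1 x) (rightLogDeriv (γ s) x w) := by
    funext s
    exact ((hlin (A (γ s x)) η v hη).sub
      (hη.hasDerivAt_apply hA x (rightLogDeriv (γ s) x w))).deriv
  rw [hinner, toOneForm_neebCochain]
  exact (hγ.hasDerivAt_apply hA x _).sub (hlin _ γ u hγ)

/-- If the left 1-cocycle `a` integrates `α`, so does the right 1-cocycle `g ↦ a g ∘ Ad g`. -/
theorem IsLeftOneCocycle.integrates {a : G → Module.Dual ℝ (GroupLieAlgebra I G)}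
    {α : GroupLieAlgebra I G →ₗ[ℝ] Module.Dual ℝ (GroupLieAlgebra I G)}
    (h : IsLeftOneCocycle a) (ha : Integrates a α) :
    Integrates (fun g => coadjoint g⁻¹ (a g)) α := by
  set L : G → E →L[ℝ] ℝ := fun g => dualToModel (a g) with hL
  set A : G → E →L[ℝ] E := fun g => Ad I g with hAd
  have hLs : ContMDiff I 𝓘(ℝ, E →L[ℝ] ℝ) ∞ L :=
    contMDiff_toContinuousLinearMap (E := E) (A := fun g => (show E →ₗ[ℝ] ℝ from a g)) ha.smooth
  have hAs : ContMDiff I 𝓘(ℝ, E →L[ℝ] E) ∞ A := contMDiff_ad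
  have heq : ∀ y : E, (fun g => coadjoint (I := I) g⁻¹ (a g) y) = fun g => L g (A g y) := by
    intro y
    funext g
    simp only [coadjoint, inv_inv]
    rfl
  have hAy : ∀ y : E, ContMDiff I 𝓘(ℝ, E) ∞ (fun g => A g y) := fun y =>
    hAs.clm_apply contMDiff_const
  have hcoc : IsRightOneCocycle (fun g => coadjoint (I := I) g⁻¹ (a g)) := h.isRightOneCocycle
  have hA1 : A 1 = ContinuousLinearMap.id ℝ E := ad_one
  have hL1 : L 1 = 0 := by
    have h1 := hcoc.map_one
    ext y
    have h2 := congrFun (heq y) 1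
    rw [hA1] at h2
    exact h2.symm.trans (congrArg (fun T => T y) h1)
  refine ⟨fun y => ?_, fun z (y : E) => ?_⟩
  · exact (heq y).symm ▸ hLs.clm_apply (hAy y)
  · have hd := modelDeriv_bilin (J := I) (x := (1 : G)) (ContinuousLinearMap.id ℝ (E →L[ℝ] ℝ))
      (hLs.mdifferentiableAt (by simp)) ((hAy y).mdifferentiableAt (by simp)) z
    have hev := modelDeriv_clm_comp (J := I) (x := (1 : G)) (ContinuousLinearMap.apply ℝ ℝ y)
      (hLs.mdifferentiableAt (by simp))
    have hev' := congrArg (fun T : E →L[ℝ] ℝ => T z) hev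
    refine Eq.trans ?_ (ha.deriv_one z y)
    refine (congrArg (fun f => modelDeriv I 𝓘(ℝ, ℝ) f (1 : G) z) (heq y)).trans ?_
    refine hd.trans ?_
    rw [hL1, hA1]
    simp only [map_zero, zero_apply, add_zero]
    exact hev'.symm

end Associated

end CurrentCocycle

end

theorem proposition2p4
    {E : Type*} [NormedAddCommGroup E] [NormedSpace ℝ E] [FiniteDimensional ℝ E]
    {H : Type*} [TopologicalSpace H] {I : ModelWithCorners ℝ E H} [I.Boundaryless]
    {G : Type*} [TopologicalSpace G] [ChartedSpace H G] [Group G] [LieGroup I ∞ G]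
    {F : Type*} [NormedAddCommGroup F] [NormedSpace ℝ F] [FiniteDimensional ℝ F]
    {H' : Type*} [TopologicalSpace H'] {J : ModelWithCorners ℝ F H'} [J.Boundaryless]
    {S : Type*} [TopologicalSpace S] [ChartedSpace H' S] [IsManifold J ∞ S]
    (α : GroupLieAlgebra I G →ₗ[ℝ] Module.Dual ℝ (GroupLieAlgebra I G))
    (hα : LieModule.Cohomology.d₁₂ ℝ (GroupLieAlgebra I G)
      (Module.Dual ℝ (GroupLieAlgebra I G)) α = 0) :
    -- the Neeb cocycle
    ∃ σ : LieModule.Cohomology.twoCocycle ℝ (CurrentCocycle.CurrentAlgebra I G J S)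
        (CurrentCocycle.TrivialOneForm I G J S),
      (∀ u v (x : S) (w : TangentSpace J x),
        CurrentCocycle.toOneForm I G J S (σ.1 u v) x w = CurrentCocycle.neebForm α u v x w) ∧
      -- `a` is a 1-cocycle for the right coadjoint action: `c(g₁, g₂) = a(g₁)(dg₂ g₂⁻¹)`
      (∀ a : G → Module.Dual ℝ (GroupLieAlgebra I G),
        CurrentCocycle.IsRightOneCocycle a → CurrentCocycle.Integrates a α →
        ∃ c : CurrentCocycle.CurrentGroup I G J S → CurrentCocycle.CurrentGroup I G J S →
            CurrentCocycle.OneForm J S,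
          (∀ g₁ g₂ (x : S) (w : TangentSpace J x),
            c g₁ g₂ x w = a (g₁ x) (CurrentCocycle.rightLogDeriv g₂ x w)) ∧
          CurrentCocycle.IsGroupTwoCocycle c ∧ CurrentCocycle.IsSmoothCochain c ∧
          CurrentCocycle.IsAssociated c (fun u v => CurrentCocycle.toOneForm I G J S (σ.1 u v))) ∧
      -- `a` is a 1-cocycle for the left coadjoint action:
      -- `c(g₁, g₂) = (Ad*_{g₁⁻¹} a(g₁))(dg₂ g₂⁻¹)`
      (∀ a : G → Module.Dual ℝ (GroupLieAlgebra I G),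
        CurrentCocycle.IsLeftOneCocycle a → CurrentCocycle.Integrates a α →
        ∃ c : CurrentCocycle.CurrentGroup I G J S → CurrentCocycle.CurrentGroup I G J S →
            CurrentCocycle.OneForm J S,
          (∀ g₁ g₂ (x : S) (w : TangentSpace J x),
            c g₁ g₂ x w = CurrentCocycle.coadjoint (g₁ x)⁻¹ (a (g₁ x))
              (CurrentCocycle.rightLogDeriv g₂ x w)) ∧
          CurrentCocycle.IsGroupTwoCocycle c ∧ CurrentCocycle.IsSmoothCochain c ∧
          CurrentCocycle.IsAssociated c
            (fun u v => CurrentCocycle.toOneForm I G J S (σ.1 u v))) := by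
  refine ⟨⟨CurrentCocycle.neebCochain α, CurrentCocycle.neebCochain_mem_twoCocycle hα⟩,
    fun u v x w => ?_, fun a ha hint => ?_, fun a ha hint => ?_⟩
  · exact (CurrentCocycle.toOneForm_neebCochain α u v x w).trans
      (CurrentCocycle.neebForm_eq u v x w).symm
  · exact ⟨CurrentCocycle.pairingCochain a hint.smooth,
      CurrentCocycle.pairingCochain_apply a hint.smooth,
      ha.isGroupTwoCocycle hint.smooth,
      CurrentCocycle.isSmoothCochain_pairingCochain a hint.smooth,
      CurrentCocycle.isAssociated_pairingCochain hint⟩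
  · have hint' := ha.integrates hint
    exact ⟨CurrentCocycle.pairingCochain _ hint'.smooth,
      CurrentCocycle.pairingCochain_apply _ hint'.smooth,
      ha.isRightOneCocycle.isGroupTwoCocycle hint'.smooth,
      CurrentCocycle.isSmoothCochain_pairingCochain _ hint'.smooth,
      CurrentCocycle.isAssociated_pairingCochain hint'⟩
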